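/- Let $\mathcal H^{I_1},\mathcal H^{O_1},\mathcal H^{I_2},\mathcal H^{O_2}$ be finite-dimensional Hilbert spaces with $d_{I_1}=d_{I_2}$ and $d_{O_1}=d_{O_2}$, and write ${}_XA:=\mathrm{Tr}_X A\otimes \mathbb 1^X/d_X$. Call a positive semidefinite operator $W$ on $\mathcal H^{I_1}\otimes\mathcal H^{O_1}\otimes\mathcal H^{I_2}\otimes\mathcal H^{O_2}$ with $\mathrm{Tr}\,W=d_{O_1}d_{O_2}$ (PAR) a parallel process if $W={}_{O_1O_2}W$; (SEQ) a sequential process (slot 1 before slot 2) if $W={}_{O_2}W$ and ${}_{I_2O_2}W={}_{O_1I_2O_2}W$; (SEP) a separable process if $W=qW^{1\prec2}+(1-q)W^{2\prec1}$ with $0\le q\le1$, $W^{1\prec 2}$ a sequential process and $W^{2\prec1}$ a sequential process with the roles of slots 1 and 2 exchanged; (GEN) a general process if ${}_{I_1O_1}W={}_{I_1O_1O_2}W$, ${}_{I_2O_2}W={}_{O_1I_2O_2}W$ and $W={}_{O_1}W+{}_{O_2}W-{}_{O_1O_2}W$. A tester with strategy $\mathcal S\in\{\mathrm{PAR},\mathrm{SEQ},\mathrm{SEP},\mathrm{GEN}\}$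 is a family $\{T_i\}_{i=1}^N$ of positive semidefinite operators whose sum is a process of kind $\mathcal S$. For an ensemble $\{p_i,\widetilde C_i\}_{i=1}^N$ of quantum channels with Choi operators $C_i=\sum_{j,k}|j\rangle\langle k|\otimes\widetilde C_i(|j\rangle\langle k|)$, the maximal probability of successful discrimination with two copies is $$P^{\mathcal S}:=\max_{\{T_i\}}\sum_{i=1}^N p_i\,\mathrm{Tr}\bigl(T_i\,C_i^{\otimes2}\bigr),$$ the maximum being over all testers with strategy $\mathcal S$. Theorem. There is an ensemble of $N=2$ qubit-to-qubit channels for which all four maxima exist and $$P^{\mathrm{PAR}}<P^{\mathrm{SEQ}}<P^{\mathrm{SEP}}<P^{\mathrm{GEN}}.$$ More precisely, this holds for $p_1=p_2=\tfrac12$, $\widetilde C_1(\rho)=K_0\rho K_0^\dagger+K_1\rho K_1^\dagger$ the amplitude-damping channel with $K_0=|0\rangle\langle0|+\sqrt{1-\gamma}\,|1\rangle\langle1|$, $K_1=\sqrt\gamma\,|0\rangle\langle1|$, $\gamma=\tfrac{67}{100}$, and $\widetilde C_2(\rho)=\eta\rho+(1-\eta)\sigma_x\rho\sigma_x$ the bit-flip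 channel with $\eta=\tfrac{87}{100}$; for this ensemble $$\tfrac{8346}{10000}<P^{\mathrm{PAR}}<\tfrac{8347}{10000},\quad \tfrac{8446}{10000}<P^{\mathrm{SEQ}}<\tfrac{8447}{10000},\quad \tfrac{8486}{10000}<P^{\mathrm{SEP}}<\tfrac{8487}{10000},\quad \tfrac{8514}{10000}<P^{\mathrm{GEN}}<\tfrac{8515}{10000}.$$ -/

import Mathlib

open scoped Matrix Kronecker ComplexOrder

noncomputable section

namespace ChannelDiscrimination

/-! ### Quantum channels -/

section Channels

variable {I O : Type} [Fintype I] [DecidableEq I] [Fintype O] [DecidableEq O]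

/-- The map `id_k ⊗ Φ`, which applies `Φ` to each block of a `k × k` block matrix. -/
def ampliation (Φ : Matrix I I ℂ →ₗ[ℂ] Matrix O O ℂ) (k : ℕ)
    (M : Matrix (Fin k × I) (Fin k × I) ℂ) : Matrix (Fin k × O) (Fin k × O) ℂ :=
  Matrix.of fun x y => Φ (Matrix.of fun i j => M (x.1, i) (y.1, j)) x.2 y.2

/-- Complete positivity: every ampliation `id_k ⊗ Φ` preserves positive semidefiniteness. -/
def IsCompletelyPositive (Φ : Matrix I I ℂ →ₗ[ℂ] Matrix O O ℂ) : Prop :=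
  ∀ (k : ℕ) (M : Matrix (Fin k × I) (Fin k × I) ℂ),
    M.PosSemidef → (ampliation Φ k M).PosSemidef

/-- Trace preservation. -/
def IsTracePreserving (Φ : Matrix I I ℂ →ₗ[ℂ] Matrix O O ℂ) : Prop :=
  ∀ ρ : Matrix I I ℂ, (Φ ρ).trace = ρ.trace

/-- A quantum channel: a completely positive trace-preserving linear map. -/
def IsQuantumChannel (Φ : Matrix I I ℂ →ₗ[ℂ] Matrix O O ℂ) : Prop :=
  IsCompletelyPositive Φ ∧ IsTracePreserving Φ

/-- The Choi operator `∑ i j, |i⟩⟨j| ⊗ Φ(|i⟩⟨j|)` on `H^I ⊗ H^O`. -/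
def choi (Φ : Matrix I I ℂ →ₗ[ℂ] Matrix O O ℂ) : Matrix (I × O) (I × O) ℂ :=
  Matrix.of fun x y => Φ (Matrix.single x.1 y.1 1) x.2 y.2

end Channels

/-- The completely positive map `ρ ↦ K ρ K†`. -/
def conjMap {I O : Type} [Fintype I] (K : Matrix O I ℂ) :
    Matrix I I ℂ →ₗ[ℂ] Matrix O O ℂ where
  toFun ρ := K * ρ * Kᴴ
  map_add' ρ σ := by rw [Matrix.mul_add, Matrix.add_mul]
  map_smul' c ρ := by simp

/-- The qubit amplitude-damping channel with damping parameter `γ`, with Kraus operators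
`|0⟩⟨0| + √(1-γ) |1⟩⟨1|` and `√γ |0⟩⟨1|`. -/
def amplitudeDamping (γ : ℝ) : Matrix (Fin 2) (Fin 2) ℂ →ₗ[ℂ] Matrix (Fin 2) (Fin 2) ℂ :=
  conjMap !![1, 0; 0, (Real.sqrt (1 - γ) : ℂ)] + conjMap !![0, (Real.sqrt γ : ℂ); 0, 0]

/-- The qubit bit-flip channel `ρ ↦ η ρ + (1-η) σₓ ρ σₓ`. -/
def bitFlip (η : ℝ) : Matrix (Fin 2) (Fin 2) ℂ →ₗ[ℂ] Matrix (Fin 2) (Fin 2) ℂ :=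
  (η : ℂ) • LinearMap.id + ((1 - η : ℝ) : ℂ) • conjMap !![0, 1; 1, 0]

/-! ### Processes and testers

Operators on `H^{I₁} ⊗ H^{O₁} ⊗ H^{I₂} ⊗ H^{O₂}` are matrices indexed by `(I × O) × (I × O)`,
the first factor being slot 1 and the second being slot 2. -/

section Testers

variable {I O : Type} [Fintype I] [DecidableEq I] [Fintype O] [DecidableEq O]

/-- Operators on the four systems `I₁ O₁ I₂ O₂`. -/
abbrev TwoSlot (I O : Type) := Matrix ((I × O) × (I × O)) ((I × O) × (I × O)) ℂ

/-- Trace-and-replace on `I₁`: `Tr_{I₁} W ⊗ 𝟙 / d_{I₁}`. -/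
def replaceI₁ (W : TwoSlot I O) : TwoSlot I O :=
  Matrix.of fun x y => if x.1.1 = y.1.1 then
    (∑ i : I, W ((i, x.1.2), x.2) ((i, y.1.2), y.2)) / (Fintype.card I : ℂ) else 0

/-- Trace-and-replace on `O₁`: `Tr_{O₁} W ⊗ 𝟙 / d_{O₁}`. -/
def replaceO₁ (W : TwoSlot I O) : TwoSlot I O :=
  Matrix.of fun x y => if x.1.2 = y.1.2 then
    (∑ o : O, W ((x.1.1, o), x.2) ((y.1.1, o), y.2)) / (Fintype.card O : ℂ) else 0

/-- Trace-and-replace on `I₂`: `Tr_{I₂} W ⊗ 𝟙 / d_{I₂}`. -/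
def replaceI₂ (W : TwoSlot I O) : TwoSlot I O :=
  Matrix.of fun x y => if x.2.1 = y.2.1 then
    (∑ i : I, W (x.1, (i, x.2.2)) (y.1, (i, y.2.2))) / (Fintype.card I : ℂ) else 0

/-- Trace-and-replace on `O₂`: `Tr_{O₂} W ⊗ 𝟙 / d_{O₂}`. -/
def replaceO₂ (W : TwoSlot I O) : TwoSlot I O :=
  Matrix.of fun x y => if x.2.2 = y.2.2 then
    (∑ o : O, W (x.1, (x.2.1, o)) (y.1, (y.2.1, o))) / (Fintype.card O : ℂ) else 0

/-- Positive operators with the trace `d_{O₁} d_{O₂}` common to all processes. -/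
def IsNormalizedPositive (W : TwoSlot I O) : Prop :=
  W.PosSemidef ∧ W.trace = (Fintype.card O : ℂ) * (Fintype.card O : ℂ)

/-- Parallel processes: `W = _{O₁O₂}W`. -/
def IsParallelProcess (W : TwoSlot I O) : Prop :=
  IsNormalizedPositive W ∧ W = replaceO₁ (replaceO₂ W)

/-- Sequential processes with slot 1 before slot 2:
`W = _{O₂}W` and `_{I₂O₂}W = _{O₁I₂O₂}W`. -/
def IsSequentialProcess (W : TwoSlot I O) : Prop :=
  IsNormalizedPositive W ∧ W = replaceO₂ W ∧
    replaceI₂ (replaceO₂ W) = replaceO₁ (replaceI₂ (replaceO₂ W))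

/-- Sequential processes with slot 2 before slot 1:
`W = _{O₁}W` and `_{I₁O₁}W = _{I₁O₁O₂}W`. -/
def IsReverseSequentialProcess (W : TwoSlot I O) : Prop :=
  IsNormalizedPositive W ∧ W = replaceO₁ W ∧
    replaceI₁ (replaceO₁ W) = replaceI₁ (replaceO₁ (replaceO₂ W))

/-- Separable processes: convex mixtures of sequential processes of the two orders. -/
def IsSeparableProcess (W : TwoSlot I O) : Prop :=
  ∃ (q : ℝ) (W₁₂ W₂₁ : TwoSlot I O), 0 ≤ q ∧ q ≤ 1 ∧
    IsSequentialProcess W₁₂ ∧ IsReverseSequentialProcess W₂₁ ∧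
    W = (q : ℂ) • W₁₂ + ((1 - q : ℝ) : ℂ) • W₂₁

/-- General processes: `_{I₁O₁}W = _{I₁O₁O₂}W`, `_{I₂O₂}W = _{O₁I₂O₂}W` and
`W = _{O₁}W + _{O₂}W - _{O₁O₂}W`. -/
def IsGeneralProcess (W : TwoSlot I O) : Prop :=
  IsNormalizedPositive W ∧
    replaceI₁ (replaceO₁ W) = replaceI₁ (replaceO₁ (replaceO₂ W)) ∧
    replaceI₂ (replaceO₂ W) = replaceO₁ (replaceI₂ (replaceO₂ W)) ∧
    W = replaceO₁ W + replaceO₂ W - replaceO₁ (replaceO₂ W)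

/-- The four kinds of strategies: parallel, sequential, separable, general. -/
inductive Strategy where
  | par
  | seq
  | sep
  | gen

/-- The processes that belong to a strategy. -/
def IsProcess : Strategy → TwoSlot I O → Prop
  | .par => IsParallelProcess
  | .seq => IsSequentialProcess
  | .sep => IsSeparableProcess
  | .gen => IsGeneralProcess

/-- A tester with strategy `S`: positive semidefinite operators that sum to a process. -/
def IsTester (S : Strategy) {N : ℕ} (T : Fin N → TwoSlot I O) : Prop :=
  (∀ i, (T i).PosSemidef) ∧ IsProcess S (∑ i, T i)

end Testers

/-! ### Discrimination of channel ensembles -/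

/-- An ensemble of `N` quantum channels, each with its probability. -/
structure ChannelEnsemble (I O : Type) [Fintype I] [DecidableEq I] [Fintype O] [DecidableEq O]
    (N : ℕ) where
  prob : Fin N → ℝ
  prob_nonneg : ∀ i, 0 ≤ prob i
  prob_sum : ∑ i, prob i = 1
  channel : Fin N → (Matrix I I ℂ →ₗ[ℂ] Matrix O O ℂ)
  isQuantumChannel : ∀ i, IsQuantumChannel (channel i)

section Success

variable {I O : Type} [Fintype I] [DecidableEq I] [Fintype O] [DecidableEq O] {N : ℕ}

/-- The success probability `∑ i, p_i Tr(T_i (C_i ⊗ C_i))` of a tester on two copies, where `C_i`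
is the Choi operator of the `i`-th channel. For a tester each trace is a real number. -/
def ChannelEnsemble.success (E : ChannelEnsemble I O N) (T : Fin N → TwoSlot I O) : ℝ :=
  ∑ i, E.prob i * (T i * (choi (E.channel i) ⊗ₖ choi (E.channel i))).trace.re

/-- The success probabilities attained by the testers with strategy `S`. -/
def ChannelEnsemble.successSet (E : ChannelEnsemble I O N) (S : Strategy) : Set ℝ :=
  {x | ∃ T : Fin N → TwoSlot I O, IsTester S T ∧ x = E.success T}

/-- The maximal probability of success with strategy `S`. -/
def ChannelEnsemble.maxSuccess (E : ChannelEnsemble I O N) (S : Strategy) : ℝ :=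
  sSup (E.successSet S)

end Success

end ChannelDiscrimination

end

/-!
A pair of operators bounds the value from both sides. If `M - p_i C_i ⊗ C_i` is positive
semidefinite for every `i`, then `∑ p_i Tr(T_i (C_i ⊗ C_i)) ≤ Tr(W M)` for the process
`W = ∑ T_i`; trace-and-replace maps are self-adjoint, so the linear conditions that define `W` can
be moved to `M`, and when they turn `M` into a multiple `c • 1`, the bound is `c d_{O₁} d_{O₂}`,
the same for all testers. For separable processes the bound comes from a majorant of `M` that
treats the slots in one order; the other order follows because `M` commutes with the exchange of
the slots. Any tester gives a lower bound, and the maxima exist because testers form a compact set.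

The testers and the operators `M` below are rounded solutions of the four semidefinite programs
with rational entries. All of them preserve the parities `i₁ + o₁` and `i₂ + o₂`, so positivity is a
question of `4 × 4` blocks, settled by exact Gaussian elimination. The ensemble itself is irrational
only through `s = √(1 - γ)`; since `s² = 1 - γ`, two copies are affine in `s`, and every inequality
follows from the same inequality at two rational numbers enclosing `s`.
-/

noncomputable section

namespace ChannelDiscrimination

open Matrix

/-! ### Positive semidefinite matrices -/

section PosSemidef

variable {𝕜 : Type*} [RCLike 𝕜]

theorem trace_mul_nonneg {n : Type*} [Fintype n] {A B : Matrix n n 𝕜}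
    (hA : A.PosSemidef) (hB : B.PosSemidef) : 0 ≤ (A * B).trace := by
  classical
  obtain ⟨m, v, rfl⟩ := posSemidef_iff_eq_sum_vecMulVec.mp hA
  rw [Finset.sum_mul, trace_sum]
  refine Finset.sum_nonneg fun i _ => ?_
  rw [vecMulVec_mul, trace_vecMulVec, dotProduct_comm, ← dotProduct_mulVec]
  exact hB.dotProduct_mulVec_nonneg _

theorem re_trace_mul_le_of_posSemidef_sub {n : Type*} [Fintype n] {W A B : Matrix n n 𝕜}
    (hW : W.PosSemidef) (hAB : (B - A).PosSemidef) :
    RCLike.re (W * A).trace ≤ RCLike.re (W * B).trace := by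
  have h := (RCLike.nonneg_iff.1 (trace_mul_nonneg hW hAB)).1
  rw [mul_sub, trace_sub, map_sub] at h
  exact sub_nonneg.1 h

theorem posSemidef_blockDiagonal {m o : Type*} [Finite m] [Finite o] [DecidableEq o]
    {M : o → Matrix m m 𝕜} (hM : ∀ k, (M k).PosSemidef) :
    (blockDiagonal M).PosSemidef := by
  have := Fintype.ofFinite m
  have := Fintype.ofFinite o
  have decomposition : blockDiagonal M =
      ∑ k, M k ⊗ₖ vecMulVec (Pi.single k 1) (star (Pi.single k 1)) := by
    ext ⟨i, k⟩ ⟨j, l⟩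
    by_cases h : k = l <;>
      simp [h, blockDiagonal_apply, Matrix.sum_apply, vecMulVec_apply, Pi.single_apply, apply_ite]
  rw [decomposition]
  exact posSemidef_sum _ fun k _ => (hM k).kronecker (posSemidef_vecMulVec_self_star _)

theorem norm_apply_le_trace_of_posSemidef {n : Type*} [Fintype n] {A : Matrix n n 𝕜}
    (hA : A.PosSemidef) (i j : n) : ‖A i j‖ ≤ RCLike.re A.trace := by
  have diag_le_trace (k : n) : A k k ≤ A.trace :=
    Finset.single_le_sum (f := A.diag) (fun _ _ => hA.diag_nonneg) (Finset.mem_univ k)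
  have minor_nonneg : 0 ≤ A i i * A j j - A i j * A j i :=
    (hA.submatrix ![i, j]).det_nonneg.trans_eq (det_fin_two _)
  have trace_eq : (RCLike.re A.trace : 𝕜) = A.trace :=
    RCLike.conj_eq_iff_re.1 (RCLike.conj_eq_iff_im.2 (RCLike.nonneg_iff.1 hA.trace_nonneg).2)
  have norm_sq_le : ((‖A i j‖ ^ 2 : ℝ) : 𝕜) ≤ ((RCLike.re A.trace ^ 2 : ℝ) : 𝕜) := calc
    ((‖A i j‖ ^ 2 : ℝ) : 𝕜) = A i j * A j i := by
      rw [← hA.1.apply j i, RCLike.star_def, RCLike.mul_conj, RCLike.ofReal_pow]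
    _ ≤ A i i * A j j := sub_nonneg.1 minor_nonneg
    _ ≤ A.trace * A.trace :=
      mul_le_mul (diag_le_trace i) (diag_le_trace j) hA.diag_nonneg hA.trace_nonneg
    _ = ((RCLike.re A.trace ^ 2 : ℝ) : 𝕜) := by rw [RCLike.ofReal_pow, trace_eq, sq]
  exact le_of_sq_le_sq (RCLike.ofReal_le_ofReal.1 norm_sq_le)
    (RCLike.nonneg_iff.1 hA.trace_nonneg).1

theorem isClosed_posSemidef (n : Type*) [Finite n] :
    IsClosed {A : Matrix n n 𝕜 | A.PosSemidef} := by
  have := Fintype.ofFinite n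
  simp only [posSemidef_iff_dotProduct_mulVec, IsHermitian, Set.ofPred_and, Set.ofPred_forall]
  refine (isClosed_eq (by fun_prop) (by fun_prop)).inter (isClosed_iInter fun x => ?_)
  exact isClosed_le (by fun_prop) (by fun_prop)

theorem isCompact_posSemidef_trace_le (n : Type*) [Fintype n] (c : ℝ) :
    IsCompact {A : Matrix n n 𝕜 | A.PosSemidef ∧ RCLike.re A.trace ≤ c} := by
  refine IsCompact.of_isClosed_subset (s := Set.univ.pi fun _ => Set.univ.pi fun _ =>
    Metric.closedBall 0 c) ?_ ?_ ?_
  · exact isCompact_univ_pi fun _ => isCompact_univ_pi fun _ => isCompact_closedBall _ _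
  · exact (isClosed_posSemidef n).inter
      (isClosed_le (RCLike.continuous_re.comp continuous_id.matrix_trace) continuous_const)
  · intro A hA i _ j _
    exact mem_closedBall_zero_iff.2 ((norm_apply_le_trace_of_posSemidef hA.1 i j).trans hA.2)

/-- Schur complement of the corner entry of a square matrix, meaningful when that entry is
nonzero. -/
def schurComplement {K : Type*} [Field K] {n : ℕ} (A : Matrix (Fin (n + 1)) (Fin (n + 1)) K) :
    Matrix (Fin n) (Fin n) K :=
  of fun i j => A i.succ j.succ - A i.succ 0 * A 0 j.succ / A 0 0

/-- Positivity of all pivots of Gaussian elimination without row exchanges, a decidable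
certificate of positive definiteness for symmetric matrices. -/
def HasPositivePivots {K : Type*} [Field K] [LT K] :
    {n : ℕ} → Matrix (Fin n) (Fin n) K → Prop
  | 0, _ => True
  | _ + 1, A => 0 < A 0 0 ∧ HasPositivePivots (schurComplement A)

instance HasPositivePivots.decidable {K : Type*} [Field K] [LT K] [DecidableLT K] :
    {n : ℕ} → (A : Matrix (Fin n) (Fin n) K) → Decidable (HasPositivePivots A)
  | 0, _ => isTrue trivial
  | _ + 1, A => @instDecidableAnd _ _ _ (HasPositivePivots.decidable (schurComplement A))

theorem HasPositivePivots.map {K L : Type*} [Field K] [LT K] [Field L] [LT L] (f : K →+* L)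
    (hf : ∀ x, 0 < x → 0 < f x) {n : ℕ} {A : Matrix (Fin n) (Fin n) K}
    (hA : HasPositivePivots A) : HasPositivePivots (A.map f) := by
  induction n with
  | zero => trivial
  | succ n ih =>
    have hS : schurComplement (A.map f) = (schurComplement A).map f := by
      ext i j
      simp [schurComplement]
    exact ⟨hf _ hA.1, hS ▸ ih hA.2⟩

theorem isHermitian_schurComplement {n : ℕ} {A : Matrix (Fin (n + 1)) (Fin (n + 1)) 𝕜}
    (hA : A.IsHermitian) : (schurComplement A).IsHermitian := by
  ext i j
  simp only [schurComplement, conjTranspose_apply, of_apply, star_sub, star_div₀, star_mul',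
    hA.apply]
  ring

theorem posSemidef_of_schurComplement {n : ℕ} {A : Matrix (Fin (n + 1)) (Fin (n + 1)) 𝕜}
    (hA : A.IsHermitian) (h0 : 0 < A 0 0) (hS : (schurComplement A).PosSemidef) :
    A.PosSemidef := by
  let E : Matrix (Fin n) (Fin (n + 1)) 𝕜 := (1 : Matrix _ _ 𝕜).submatrix Fin.succ id
  have decomposition : A = (A 0 0)⁻¹ • vecMulVec (fun i => A i 0) (star fun i => A i 0) +
      Eᴴ * schurComplement A * E := by
    ext i j
    have := h0.ne'
    simp only [E, Matrix.add_apply, Matrix.smul_apply, vecMulVec_apply, Pi.star_apply, hA.apply,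
      mul_apply, conjTranspose_apply, submatrix_apply, one_apply, schurComplement, of_apply]
    refine Fin.cases ?_ (fun i => ?_) i <;> refine Fin.cases ?_ (fun j => ?_) j <;>
      (simp [Fin.succ_ne_zero, eq_comm, apply_ite]; field_simp; try ring)
  rw [decomposition]
  exact ((posSemidef_vecMulVec_self_star _).smul (inv_nonneg.2 h0.le)).add
    (hS.conjTranspose_mul_mul_same E)

theorem HasPositivePivots.posSemidef {n : ℕ} {A : Matrix (Fin n) (Fin n) 𝕜}
    (h : HasPositivePivots A) (hA : A.IsHermitian) : A.PosSemidef := by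
  induction n with
  | zero => exact Subsingleton.elim 0 A ▸ .zero
  | succ n ih =>
    exact posSemidef_of_schurComplement hA h.1 (ih h.2 (isHermitian_schurComplement hA))

end PosSemidef

/-! ### Trace-and-replace -/

section TraceReplace

variable {n A B K : Type*} [Fintype B] [DecidableEq B] [Field K]

/-- Trace-and-replace on the factor `B` of an index type split as `A × B`, over any field, so that
it applies to complex operators and to rational certificates alike. -/
def traceReplace (e : n ≃ A × B) : Matrix n n K →ₗ[K] Matrix n n K where
  toFun W := of fun x y => if (e x).2 = (e y).2 then
    (∑ b, W (e.symm ((e x).1, b)) (e.symm ((e y).1, b))) / (Fintype.card B : K) else 0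
  map_add' W M := by
    ext x y
    simp only [of_apply, Matrix.add_apply, Finset.sum_add_distrib, add_div, ite_add_zero]
  map_smul' c W := by
    ext x y
    simp only [of_apply, Matrix.smul_apply, ← Finset.smul_sum, smul_div_assoc, smul_ite, smul_zero,
      RingHom.id_apply]

theorem traceReplace_apply (e : n ≃ A × B) (W : Matrix n n K) (x y : n) :
    traceReplace e W x y = if (e x).2 = (e y).2 then
      (∑ b, W (e.symm ((e x).1, b)) (e.symm ((e y).1, b))) / (Fintype.card B : K) else 0 :=
  rfl

theorem trace_traceReplace_mul [Fintype n] [Finite A] (e : n ≃ A × B) (W M : Matrix n n K) :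
    (traceReplace e W * M).trace = (W * traceReplace e M).trace := by
  have := Fintype.ofFinite A
  simp only [trace, diag, mul_apply, traceReplace_apply]
  rw [← e.symm.sum_comp, ← e.symm.sum_comp]
  simp_rw [← e.symm.sum_comp (fun _ => _ * _), Equiv.apply_symm_apply, Fintype.sum_prod_type,
    ite_mul, mul_ite, zero_mul, mul_zero, Finset.sum_ite_eq, Finset.mem_univ, if_true]
  refine Finset.sum_congr rfl fun a _ => ?_
  rw [Finset.sum_comm, Finset.sum_comm (s := (Finset.univ : Finset B))]
  refine Finset.sum_congr rfl fun a' _ => ?_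
  simp only [Finset.sum_ite_eq', Finset.mem_univ, if_true]
  rw [← Finset.mul_sum, ← Finset.sum_mul]
  ring

theorem traceReplace_one [DecidableEq n] [CharZero K] (e : n ≃ A × B) :
    traceReplace e (1 : Matrix n n K) = 1 := by
  ext x y
  have : Nonempty B := ⟨(e x).2⟩
  have card_ne_zero : (Fintype.card B : K) ≠ 0 := Nat.cast_ne_zero.2 Fintype.card_ne_zero
  have eq_iff : x = y ↔ (e x).1 = (e y).1 ∧ (e x).2 = (e y).2 := by
    rw [← Prod.ext_iff, e.apply_eq_iff_eq]
  by_cases h₁ : (e x).1 = (e y).1 <;> by_cases h₂ : (e x).2 = (e y).2 <;>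
    simp [traceReplace_apply, one_apply, eq_iff, h₁, h₂, card_ne_zero]

theorem traceReplace_map {L : Type*} [Field L] (e : n ≃ A × B) (f : K →+* L)
    (W : Matrix n n K) : traceReplace e (W.map f) = (traceReplace e W).map f := by
  ext x y
  simp [traceReplace_apply, apply_ite f]

@[fun_prop]
theorem continuous_traceReplace [TopologicalSpace K] [IsTopologicalRing K] (e : n ≃ A × B) :
    Continuous fun W : Matrix n n K => traceReplace e W := by
  refine continuous_matrix fun x y => ?_
  simp only [traceReplace_apply]
  split_ifs <;> fun_prop

end TraceReplace

section TwoSlot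

variable {I O : Type}

/-- The factor `I₁` split off from the four systems `I₁ O₁ I₂ O₂`. -/
def splitI₁ : (I × O) × (I × O) ≃ (O × (I × O)) × I :=
  ⟨fun x => ((x.1.2, x.2), x.1.1), fun y => ((y.2, y.1.1), y.1.2), fun _ => rfl, fun _ => rfl⟩

/-- The factor `O₁` split off from the four systems `I₁ O₁ I₂ O₂`. -/
def splitO₁ : (I × O) × (I × O) ≃ (I × (I × O)) × O :=
  ⟨fun x => ((x.1.1, x.2), x.1.2), fun y => ((y.1.1, y.2), y.1.2), fun _ => rfl, fun _ => rfl⟩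

/-- The factor `I₂` split off from the four systems `I₁ O₁ I₂ O₂`. -/
def splitI₂ : (I × O) × (I × O) ≃ ((I × O) × O) × I :=
  ⟨fun x => ((x.1, x.2.2), x.2.1), fun y => (y.1.1, (y.2, y.1.2)), fun _ => rfl, fun _ => rfl⟩

/-- The factor `O₂` split off from the four systems `I₁ O₁ I₂ O₂`. -/
def splitO₂ : (I × O) × (I × O) ≃ ((I × O) × I) × O :=
  ⟨fun x => ((x.1, x.2.1), x.2.2), fun y => (y.1.1, (y.1.2, y.2)), fun _ => rfl, fun _ => rfl⟩

theorem replaceI₁_eq_traceReplace [Fintype I] [DecidableEq I] :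
    (replaceI₁ : TwoSlot I O → TwoSlot I O) = traceReplace splitI₁ := rfl

theorem replaceO₁_eq_traceReplace [Fintype O] [DecidableEq O] :
    (replaceO₁ : TwoSlot I O → TwoSlot I O) = traceReplace splitO₁ := rfl

theorem replaceI₂_eq_traceReplace [Fintype I] [DecidableEq I] :
    (replaceI₂ : TwoSlot I O → TwoSlot I O) = traceReplace splitI₂ := rfl

theorem replaceO₂_eq_traceReplace [Fintype O] [DecidableEq O] :
    (replaceO₂ : TwoSlot I O → TwoSlot I O) = traceReplace splitO₂ := rfl

end TwoSlot

/-! ### Exchange of the two slots -/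

/-- The operator with the two slots exchanged. -/
def swapSlots {S R : Type*} (W : Matrix (S × S) (S × S) R) : Matrix (S × S) (S × S) R :=
  W.submatrix Prod.swap Prod.swap

section SlotExchange

variable {I O : Type}

theorem trace_swapSlots {S R : Type*} [Fintype S] [AddCommMonoid R]
    (W : Matrix (S × S) (S × S) R) : (swapSlots W).trace = W.trace :=
  (Equiv.prodComm S S).sum_comp W.diag

theorem trace_swapSlots_mul {S R : Type*} [Fintype S] [NonUnitalNonAssocSemiring R]
    (W M : Matrix (S × S) (S × S) R) :
    (swapSlots W * M).trace = (W * swapSlots M).trace := by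
  have h : swapSlots W * M = swapSlots (W * swapSlots M) :=
    submatrix_mul_equiv W (swapSlots M) Prod.swap (Equiv.prodComm _ _) Prod.swap
  rw [h, trace_swapSlots]

theorem replaceO₂_replaceI₁ [Fintype I] [DecidableEq I] [Fintype O] [DecidableEq O]
    (W : TwoSlot I O) :
    replaceO₂ (replaceI₁ W) = replaceI₁ (replaceO₂ W) := by
  ext x y
  simp only [replaceO₂, replaceI₁, of_apply, ← Finset.sum_div, Finset.sum_ite_irrel,
    Finset.sum_const_zero]
  rw [Finset.sum_comm]
  split_ifs <;> ring

theorem replaceO₂_replaceO₁ [Fintype O] [DecidableEq O] (W : TwoSlot I O) :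
    replaceO₂ (replaceO₁ W) = replaceO₁ (replaceO₂ W) := by
  ext x y
  simp only [replaceO₂, replaceO₁, of_apply, ← Finset.sum_div, Finset.sum_ite_irrel,
    Finset.sum_const_zero]
  rw [Finset.sum_comm]
  split_ifs <;> ring

theorem isNormalizedPositive_swapSlots_iff [Fintype I] [Fintype O] {W : TwoSlot I O} :
    IsNormalizedPositive (swapSlots W) ↔ IsNormalizedPositive W := by
  rw [IsNormalizedPositive, IsNormalizedPositive, trace_swapSlots]
  exact and_congr_left fun _ => posSemidef_submatrix_equiv (Equiv.prodComm _ _)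

theorem isReverseSequentialProcess_iff [Fintype I] [DecidableEq I] [Fintype O] [DecidableEq O]
    {W : TwoSlot I O} :
    IsReverseSequentialProcess W ↔ IsSequentialProcess (swapSlots W) := by
  have swap_inj {V V' : TwoSlot I O} : swapSlots V = swapSlots V' ↔ V = V' :=
    (reindex (Equiv.prodComm _ _) (Equiv.prodComm _ _)).apply_eq_iff_eq
  have replaceO₂_swap (V : TwoSlot I O) : replaceO₂ (swapSlots V) = swapSlots (replaceO₁ V) := rfl
  have replaceI₂_swap (V : TwoSlot I O) : replaceI₂ (swapSlots V) = swapSlots (replaceI₁ V) := rfl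
  have replaceO₁_swap (V : TwoSlot I O) : replaceO₁ (swapSlots V) = swapSlots (replaceO₂ V) := rfl
  simp only [IsReverseSequentialProcess, IsSequentialProcess, isNormalizedPositive_swapSlots_iff,
    replaceO₂_swap, replaceI₂_swap, replaceO₁_swap, swap_inj, replaceO₂_replaceI₁,
    replaceO₂_replaceO₁]

end SlotExchange

/-! ### Duality -/

section Duality

variable {I O : Type} [Fintype I] [DecidableEq I] [Fintype O] [DecidableEq O]

theorem IsParallelProcess.trace_mul {W M : TwoSlot I O} {c : ℂ} (hW : IsParallelProcess W)
    (hM : replaceO₂ (replaceO₁ M) = c • 1) :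
    (W * M).trace = c * (Fintype.card O * Fintype.card O) := calc
  (W * M).trace = (replaceO₁ (replaceO₂ W) * M).trace := by rw [← hW.2]
  _ = (W * replaceO₂ (replaceO₁ M)).trace := by
    simp only [replaceO₁_eq_traceReplace, replaceO₂_eq_traceReplace, trace_traceReplace_mul]
  _ = c * (Fintype.card O * Fintype.card O) := by
    rw [hM, mul_smul_comm, mul_one, trace_smul, hW.1.2, smul_eq_mul]

theorem IsSequentialProcess.trace_mul {W M : TwoSlot I O} {c : ℂ} (hW : IsSequentialProcess W)
    (hM : replaceO₂ M = replaceO₂ (replaceI₂ M))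
    (hM' : replaceO₂ (replaceI₂ (replaceO₁ M)) = c • 1) :
    (W * M).trace = c * (Fintype.card O * Fintype.card O) := calc
  (W * M).trace = (replaceO₂ W * M).trace := by rw [← hW.2.1]
  _ = (W * replaceO₂ M).trace := trace_traceReplace_mul splitO₂ W M
  _ = (replaceI₂ (replaceO₂ W) * M).trace := by
    rw [hM]
    simp only [replaceI₂_eq_traceReplace, replaceO₂_eq_traceReplace, trace_traceReplace_mul]
  _ = (W * replaceO₂ (replaceI₂ (replaceO₁ M))).trace := by
    rw [hW.2.2]
    simp only [replaceO₁_eq_traceReplace, replaceI₂_eq_traceReplace, replaceO₂_eq_traceReplace,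
      trace_traceReplace_mul]
  _ = c * (Fintype.card O * Fintype.card O) := by
    rw [hM', mul_smul_comm, mul_one, trace_smul, hW.1.2, smul_eq_mul]

theorem IsGeneralProcess.trace_mul {W M : TwoSlot I O} {c : ℂ} (hW : IsGeneralProcess W)
    (hM : replaceO₁ M + replaceO₂ M - replaceO₂ (replaceO₁ M)
      - replaceO₁ (replaceI₁ M) + replaceO₂ (replaceO₁ (replaceI₁ M))
      - replaceO₂ (replaceI₂ M) + replaceO₂ (replaceI₂ (replaceO₁ M)) = c • 1) :
    (W * M).trace = c * (Fintype.card O * Fintype.card O) := by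
  obtain ⟨⟨-, trace_W⟩, slot₁_last, slot₂_last, no_loop⟩ := hW
  have trace_slot₁_last := congrArg (fun X => (X * M).trace) slot₁_last
  have trace_slot₂_last := congrArg (fun X => (X * M).trace) slot₂_last
  have trace_no_loop := congrArg (fun X => (X * M).trace) no_loop
  have trace_hM := congrArg (fun X => (W * X).trace) hM
  simp only [replaceI₁_eq_traceReplace, replaceO₁_eq_traceReplace, replaceI₂_eq_traceReplace,
    replaceO₂_eq_traceReplace, add_mul, sub_mul, mul_add, mul_sub, trace_add, trace_sub,
    trace_traceReplace_mul, mul_smul_comm, mul_one, trace_smul, trace_W, smul_eq_mul]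
    at trace_slot₁_last trace_slot₂_last trace_no_loop trace_hM
  linear_combination trace_no_loop + trace_hM + trace_slot₁_last + trace_slot₂_last

theorem IsSeparableProcess.re_trace_mul_le {W M M' : TwoSlot I O} {l : ℝ}
    (hW : IsSeparableProcess W) (hM : swapSlots M = M) (hMM' : (M' - M).PosSemidef)
    (hl : ∀ V : TwoSlot I O, IsSequentialProcess V → (V * M').trace.re ≤ l) :
    (W * M).trace.re ≤ l := by
  obtain ⟨q, W₁₂, W₂₁, hq₀, hq₁, hW₁₂, hW₂₁, rfl⟩ := hW
  have le_of_isSequentialProcess (V : TwoSlot I O) (hV : IsSequentialProcess V) :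
      (V * M).trace.re ≤ l :=
    (re_trace_mul_le_of_posSemidef_sub hV.1.1 hMM').trans (hl V hV)
  have h₁₂ := le_of_isSequentialProcess W₁₂ hW₁₂
  have h₂₁ := le_of_isSequentialProcess (swapSlots W₂₁) (isReverseSequentialProcess_iff.1 hW₂₁)
  rw [trace_swapSlots_mul, hM] at h₂₁
  rw [add_mul, trace_add, smul_mul_assoc, smul_mul_assoc, trace_smul, trace_smul, smul_eq_mul,
    smul_eq_mul, Complex.add_re, Complex.re_ofReal_mul, Complex.re_ofReal_mul]
  linarith [mul_le_mul_of_nonneg_left h₁₂ hq₀,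
    mul_le_mul_of_nonneg_left h₂₁ (sub_nonneg.2 hq₁)]

theorem ChannelEnsemble.success_le {N : ℕ} (E : ChannelEnsemble I O N) {S : Strategy}
    {M : TwoSlot I O} {l : ℝ}
    (hM : ∀ i, (M - (E.prob i : ℂ) • (choi (E.channel i) ⊗ₖ choi (E.channel i))).PosSemidef)
    (hl : ∀ W : TwoSlot I O, IsProcess S W → (W * M).trace.re ≤ l)
    {T : Fin N → TwoSlot I O} (hT : IsTester S T) : E.success T ≤ l := by
  refine le_trans ?_ (hl _ hT.2)
  rw [Finset.sum_mul, trace_sum, Complex.re_sum]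
  refine Finset.sum_le_sum fun i _ => ?_
  calc
    _ = (T i * (E.prob i : ℂ) • (choi (E.channel i) ⊗ₖ choi (E.channel i))).trace.re := by
      rw [mul_smul_comm, trace_smul, smul_eq_mul, Complex.re_ofReal_mul]
    _ ≤ (T i * M).trace.re := re_trace_mul_le_of_posSemidef_sub (hT.1 i) (hM i)

end Duality

/-! ### Existence of the maxima -/

section Existence

variable {I O : Type}

theorem isCompact_isNormalizedPositive [Fintype I] [Fintype O] :
    IsCompact {W : TwoSlot I O | IsNormalizedPositive W} := by
  refine (isCompact_posSemidef_trace_le _ (Fintype.card O * Fintype.card O)).of_isClosed_subset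
    ((isClosed_posSemidef _).inter (isClosed_eq (by fun_prop) continuous_const)) ?_
  rintro W ⟨hW, trace_W⟩
  refine ⟨hW, ?_⟩
  rw [trace_W]
  simp

@[fun_prop]
theorem continuous_replaceI₁ [Fintype I] [DecidableEq I] :
    Continuous (replaceI₁ : TwoSlot I O → TwoSlot I O) :=
  continuous_traceReplace splitI₁

@[fun_prop]
theorem continuous_replaceO₁ [Fintype O] [DecidableEq O] :
    Continuous (replaceO₁ : TwoSlot I O → TwoSlot I O) :=
  continuous_traceReplace splitO₁

@[fun_prop]
theorem continuous_replaceI₂ [Fintype I] [DecidableEq I] :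
    Continuous (replaceI₂ : TwoSlot I O → TwoSlot I O) :=
  continuous_traceReplace splitI₂

@[fun_prop]
theorem continuous_replaceO₂ [Fintype O] [DecidableEq O] :
    Continuous (replaceO₂ : TwoSlot I O → TwoSlot I O) :=
  continuous_traceReplace splitO₂

variable [Fintype I] [DecidableEq I] [Fintype O] [DecidableEq O]

theorem IsProcess.isNormalizedPositive {S : Strategy} {W : TwoSlot I O} (hW : IsProcess S W) :
    IsNormalizedPositive W := by
  cases S with
  | par | seq | gen => exact hW.1
  | sep =>
    obtain ⟨q, W₁₂, W₂₁, hq₀, hq₁, hW₁₂, hW₂₁, rfl⟩ := hW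
    refine ⟨(hW₁₂.1.1.smul ?_).add (hW₂₁.1.1.smul ?_), ?_⟩
    · exact_mod_cast hq₀
    · exact_mod_cast sub_nonneg.2 hq₁
    · rw [trace_add, trace_smul, trace_smul, hW₁₂.1.2, hW₂₁.1.2, ← add_smul, ← Complex.ofReal_add,
        add_sub_cancel, Complex.ofReal_one, one_smul]

theorem isCompact_isSequentialProcess : IsCompact {W : TwoSlot I O | IsSequentialProcess W} := by
  refine isCompact_isNormalizedPositive.inter_right
    ((isClosed_eq ?_ ?_).inter (isClosed_eq ?_ ?_)) <;> fun_prop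

theorem isCompact_isReverseSequentialProcess :
    IsCompact {W : TwoSlot I O | IsReverseSequentialProcess W} := by
  simp only [isReverseSequentialProcess_iff]
  exact (Homeomorph.isCompact_preimage
    ⟨reindex (Equiv.prodComm _ _) (Equiv.prodComm _ _), by fun_prop, by fun_prop⟩).2
    isCompact_isSequentialProcess

theorem isCompact_isSeparableProcess : IsCompact {W : TwoSlot I O | IsSeparableProcess W} := by
  let mix (p : ℝ × TwoSlot I O × TwoSlot I O) : TwoSlot I O :=
    (p.1 : ℂ) • p.2.1 + ((1 - p.1 : ℝ) : ℂ) • p.2.2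
  have separable_eq_image : {W : TwoSlot I O | IsSeparableProcess W} =
      mix '' (Set.Icc 0 1 ×ˢ {W | IsSequentialProcess W} ×ˢ
        {W | IsReverseSequentialProcess W}) := by
    ext W
    constructor
    · rintro ⟨q, W₁₂, W₂₁, hq₀, hq₁, hW₁₂, hW₂₁, rfl⟩
      exact ⟨(q, W₁₂, W₂₁), ⟨⟨hq₀, hq₁⟩, hW₁₂, hW₂₁⟩, rfl⟩
    · rintro ⟨⟨q, W₁₂, W₂₁⟩, ⟨⟨hq₀, hq₁⟩, hW₁₂, hW₂₁⟩, rfl⟩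
      exact ⟨q, W₁₂, W₂₁, hq₀, hq₁, hW₁₂, hW₂₁, rfl⟩
  rw [separable_eq_image]
  exact (isCompact_Icc.prod (isCompact_isSequentialProcess.prod
    isCompact_isReverseSequentialProcess)).image (by fun_prop)

theorem isCompact_isProcess (S : Strategy) : IsCompact {W : TwoSlot I O | IsProcess S W} := by
  cases S with
  | par =>
    refine isCompact_isNormalizedPositive.inter_right (isClosed_eq ?_ ?_) <;> fun_prop
  | seq => exact isCompact_isSequentialProcess
  | sep => exact isCompact_isSeparableProcess
  | gen =>
    refine isCompact_isNormalizedPositive.inter_right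
      ((isClosed_eq ?_ ?_).inter ((isClosed_eq ?_ ?_).inter (isClosed_eq ?_ ?_))) <;> fun_prop

theorem isCompact_isTester (S : Strategy) (N : ℕ) :
    IsCompact {T : Fin N → TwoSlot I O | IsTester S T} := by
  refine (isCompact_univ_pi fun _ => isCompact_posSemidef_trace_le _
    (Fintype.card O * Fintype.card O)).of_isClosed_subset ?_ ?_
  · have closed_pos : IsClosed {T : Fin N → TwoSlot I O | ∀ i, (T i).PosSemidef} := by
      simp only [Set.ofPred_forall]
      exact isClosed_iInter fun i =>
        (isClosed_posSemidef _).preimage (f := fun T : Fin N → TwoSlot I O => T i) (by fun_prop)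
    have continuous_sum : Continuous fun T : Fin N → TwoSlot I O => ∑ i, T i := by fun_prop
    exact closed_pos.inter ((isCompact_isProcess S).isClosed.preimage continuous_sum)
  · intro T hT i _
    refine ⟨hT.1 i, ?_⟩
    have trace_sum_eq : (∑ j, T j).trace.re = Fintype.card O * Fintype.card O := by
      rw [hT.2.isNormalizedPositive.2]
      simp
    rw [← trace_sum_eq, trace_sum, Complex.re_sum]
    exact Finset.single_le_sum (f := fun j => (T j).trace.re)
      (fun j _ => (Complex.le_def.1 (hT.1 j).trace_nonneg).1) (Finset.mem_univ i)

theorem IsNormalizedPositive.isProcess_smul_one {c : ℂ}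
    (hc : IsNormalizedPositive (c • (1 : TwoSlot I O))) (S : Strategy) :
    IsProcess S (c • (1 : TwoSlot I O)) := by
  have fixed {A B : Type} [Fintype B] [DecidableEq B] (e : (I × O) × (I × O) ≃ A × B) :
      traceReplace e (c • (1 : TwoSlot I O)) = c • 1 := by
    rw [map_smul, traceReplace_one]
  have seq : IsSequentialProcess (c • (1 : TwoSlot I O)) :=
    ⟨hc, (fixed splitO₂).symm, by simp only [replaceO₁_eq_traceReplace,
      replaceI₂_eq_traceReplace, replaceO₂_eq_traceReplace, fixed]⟩
  cases S with
  | par =>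
    exact ⟨hc, by simp only [replaceO₁_eq_traceReplace, replaceO₂_eq_traceReplace, fixed]⟩
  | seq => exact seq
  | sep =>
    have swap_one : swapSlots (c • (1 : TwoSlot I O)) = c • 1 := by
      rw [swapSlots, submatrix_smul, Pi.smul_apply, Pi.smul_apply,
        submatrix_one _ Prod.swap_injective]
    exact ⟨1, _, _, zero_le_one, le_rfl, seq,
      isReverseSequentialProcess_iff.2 (swap_one.symm ▸ seq), by simp⟩
  | gen =>
    refine ⟨hc, ?_⟩
    simp only [replaceI₁_eq_traceReplace, replaceO₁_eq_traceReplace, replaceI₂_eq_traceReplace,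
      replaceO₂_eq_traceReplace, fixed, true_and, add_sub_cancel_right]

theorem isNormalizedPositive_smul_one [Nonempty I] :
    IsNormalizedPositive (((Fintype.card I : ℂ) ^ 2)⁻¹ • (1 : TwoSlot I O)) := by
  refine ⟨PosSemidef.one.smul (by positivity), ?_⟩
  have : (Fintype.card I : ℂ) ≠ 0 := Nat.cast_ne_zero.2 Fintype.card_ne_zero
  simp only [trace_smul, trace_one, Fintype.card_prod, Nat.cast_mul, smul_eq_mul]
  field_simp

variable {N : ℕ}

theorem ChannelEnsemble.exists_isTester [Nonempty I] (E : ChannelEnsemble I O N) (S : Strategy) :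
    ∃ T : Fin N → TwoSlot I O, IsTester S T := by
  have hW := isNormalizedPositive_smul_one (I := I) (O := O)
  refine ⟨fun i => (E.prob i : ℂ) • _,
    fun i => hW.1.smul (by exact_mod_cast E.prob_nonneg i), ?_⟩
  rw [← Finset.sum_smul, ← Complex.ofReal_sum, E.prob_sum, Complex.ofReal_one, one_smul]
  exact hW.isProcess_smul_one S

theorem ChannelEnsemble.isGreatest_maxSuccess [Nonempty I] (E : ChannelEnsemble I O N)
    (S : Strategy) : IsGreatest (E.successSet S) (E.maxSuccess S) := by
  have successSet_eq_image : E.successSet S = E.success '' {T | IsTester S T} :=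
    Set.ext fun x => exists_congr fun T => and_congr_right fun _ => eq_comm
  have continuous_success : Continuous E.success := by
    unfold ChannelEnsemble.success
    fun_prop
  obtain ⟨T, hT⟩ := E.exists_isTester S
  refine IsCompact.isGreatest_sSup ?_ ⟨_, T, hT, rfl⟩
  rw [successSet_eq_image]
  exact (isCompact_isTester S N).image continuous_success

theorem ChannelEnsemble.lt_maxSuccess [Nonempty I] (E : ChannelEnsemble I O N) {S : Strategy}
    {T : Fin N → TwoSlot I O} {l : ℝ} (hT : IsTester S T) (hl : l < E.success T) :
    l < E.maxSuccess S :=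
  hl.trans_le ((E.isGreatest_maxSuccess S).2 ⟨T, hT, rfl⟩)

theorem ChannelEnsemble.maxSuccess_le [Nonempty I] (E : ChannelEnsemble I O N) {S : Strategy}
    {M : TwoSlot I O} {l : ℝ}
    (hM : ∀ i, (M - (E.prob i : ℂ) • (choi (E.channel i) ⊗ₖ choi (E.channel i))).PosSemidef)
    (hl : ∀ W : TwoSlot I O, IsProcess S W → (W * M).trace.re ≤ l) : E.maxSuccess S ≤ l := by
  obtain ⟨T, hT, h⟩ := (E.isGreatest_maxSuccess S).1
  exact h ▸ E.success_le hM hl hT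

end Existence

/-! ### The two channels -/

section CompletelyPositive

variable {I O : Type}

theorem isCompletelyPositive_conjMap [Fintype I] [Finite O] (K : Matrix O I ℂ) :
    IsCompletelyPositive (conjMap K) := by
  have := Fintype.ofFinite O
  intro k M hM
  convert hM.mul_mul_conjTranspose_same ((1 : Matrix (Fin k) (Fin k) ℂ) ⊗ₖ K) using 1
  ext ⟨a, x⟩ ⟨b, y⟩
  simp [ampliation, conjMap, mul_apply, Fintype.sum_prod_type, one_apply, apply_ite]

theorem IsCompletelyPositive.add {Φ Ψ : Matrix I I ℂ →ₗ[ℂ] Matrix O O ℂ}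
    (hΦ : IsCompletelyPositive Φ) (hΨ : IsCompletelyPositive Ψ) :
    IsCompletelyPositive (Φ + Ψ) :=
  fun k M hM => (hΦ k M hM).add (hΨ k M hM)

theorem IsCompletelyPositive.smul {Φ : Matrix I I ℂ →ₗ[ℂ] Matrix O O ℂ}
    (hΦ : IsCompletelyPositive Φ) {c : ℂ} (hc : 0 ≤ c) : IsCompletelyPositive (c • Φ) :=
  fun k M hM => (hΦ k M hM).smul hc

theorem isCompletelyPositive_id :
    IsCompletelyPositive (LinearMap.id : Matrix I I ℂ →ₗ[ℂ] Matrix I I ℂ) :=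
  fun _ _ hM => hM

end CompletelyPositive

theorem conjMap_apply_fin_two (K ρ : Matrix (Fin 2) (Fin 2) ℂ) (i j : Fin 2) :
    conjMap K ρ i j = K i 0 * ρ 0 0 * star (K j 0) + K i 0 * ρ 0 1 * star (K j 1) +
      K i 1 * ρ 1 0 * star (K j 0) + K i 1 * ρ 1 1 * star (K j 1) := by
  simp only [conjMap, LinearMap.coe_mk, AddHom.coe_mk, mul_apply, Fin.sum_univ_two,
    conjTranspose_apply]
  ring

theorem ofReal_sqrt_mul_self {x : ℝ} (hx : 0 ≤ x) : (√x : ℂ) * √x = x := by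
  rw [← Complex.ofReal_mul, Real.mul_self_sqrt hx]

theorem isQuantumChannel_amplitudeDamping {γ : ℝ} (h0 : 0 ≤ γ) (h1 : γ ≤ 1) :
    IsQuantumChannel (amplitudeDamping γ) := by
  refine ⟨(isCompletelyPositive_conjMap _).add (isCompletelyPositive_conjMap _), fun ρ => ?_⟩
  have hs := ofReal_sqrt_mul_self (sub_nonneg.2 h1)
  have hγ := ofReal_sqrt_mul_self h0
  push_cast at hs
  simp only [amplitudeDamping, LinearMap.add_apply, trace_fin_two, Matrix.add_apply,
    conjMap_apply_fin_two, of_apply, cons_val', cons_val_zero, cons_val_one, cons_val_fin_one,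
    star_one, star_zero, RCLike.star_def, Complex.conj_ofReal]
  linear_combination ρ 1 1 * hs + ρ 1 1 * hγ

theorem isQuantumChannel_bitFlip {η : ℝ} (h0 : 0 ≤ η) (h1 : η ≤ 1) :
    IsQuantumChannel (bitFlip η) := by
  refine ⟨(isCompletelyPositive_id.smul (by exact_mod_cast h0)).add
    ((isCompletelyPositive_conjMap _).smul (by exact_mod_cast sub_nonneg.2 h1)), fun ρ => ?_⟩
  simp only [bitFlip, LinearMap.add_apply, LinearMap.smul_apply, LinearMap.id_apply, trace_fin_two,
    Matrix.add_apply, Matrix.smul_apply, smul_eq_mul, conjMap_apply_fin_two, of_apply, cons_val',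
    cons_val_zero, cons_val_one, cons_val_fin_one, star_one, star_zero]
  push_cast
  ring

/-- The equiprobable ensemble of the amplitude-damping channel with `γ = 67/100` and the bit-flip
channel with `η = 87/100`. -/
def dampingFlipEnsemble : ChannelEnsemble (Fin 2) (Fin 2) 2 where
  prob _ := 1 / 2
  prob_nonneg _ := by norm_num
  prob_sum := by norm_num
  channel := ![amplitudeDamping (67 / 100), bitFlip (87 / 100)]
  isQuantumChannel := Fin.forall_fin_two.2
    ⟨isQuantumChannel_amplitudeDamping (by norm_num) (by norm_num),
      isQuantumChannel_bitFlip (by norm_num) (by norm_num)⟩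

/-- Basis labels of the input and output qubit of one slot. -/
abbrev QubitPair := Fin 2 × Fin 2

section ChoiOperators

variable {R : Type*} [CommRing R]

/-- The diagonal of the Choi operator of the amplitude-damping channel, over any ring, so that it
serves the complex operator and its rational approximations. -/
def dampingPopulations (γ : R) : Matrix QubitPair QubitPair R :=
  diagonal fun x => ![![1, 0], ![γ, 1 - γ]] x.1 x.2

/-- The coherences `|00⟩⟨11| + |11⟩⟨00|`, which the amplitude-damping channel multiplies by
`√(1 - γ)`. -/
def bellCoherences : Matrix QubitPair QubitPair R :=
  of fun x y => if x.1 = x.2 ∧ y.1 = y.2 ∧ x ≠ y then 1 else 0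

/-- The Choi operator of the bit-flip channel, over any ring. -/
def bitFlipChoi (η : R) : Matrix QubitPair QubitPair R :=
  of fun x y => if x.1 = x.2 ∧ y.1 = y.2 then η else if x.1 ≠ x.2 ∧ y.1 ≠ y.2 then 1 - η else 0

/-- Two copies of the Choi operator of the amplitude-damping channel, where `s` stands for
`√(1 - γ)`. The term in `s²` is written with `1 - γ`, which makes the operator affine in `s`. -/
def twoDampings (γ s : R) : Matrix (QubitPair × QubitPair) (QubitPair × QubitPair) R :=
  dampingPopulations γ ⊗ₖ dampingPopulations γ + (1 - γ) • bellCoherences ⊗ₖ bellCoherences +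
    s • (dampingPopulations γ ⊗ₖ bellCoherences + bellCoherences ⊗ₖ dampingPopulations γ)

theorem map_dampingPopulations {S : Type*} [CommRing S] (f : R →+* S) (γ : R) :
    (dampingPopulations γ).map f = dampingPopulations (f γ) := by
  rw [dampingPopulations, diagonal_map (map_zero f)]
  refine congrArg diagonal (funext fun x => ?_)
  fin_cases x <;> simp

theorem map_bellCoherences {S : Type*} [CommRing S] (f : R →+* S) :
    (bellCoherences : Matrix QubitPair QubitPair R).map f = bellCoherences := by
  ext x y
  simp [bellCoherences, apply_ite f]

theorem map_twoDampings {S : Type*} [CommRing S] (f : R →+* S) (γ s : R) :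
    (twoDampings γ s).map f = twoDampings (f γ) (f s) := by
  rw [twoDampings, twoDampings, ← map_dampingPopulations f, ← map_bellCoherences f]
  ext x y
  simp

end ChoiOperators

theorem choi_amplitudeDamping {γ : ℝ} (h0 : 0 ≤ γ) (h1 : γ ≤ 1) :
    choi (amplitudeDamping γ) = dampingPopulations (γ : ℂ) + (√(1 - γ) : ℂ) • bellCoherences := by
  have hs := ofReal_sqrt_mul_self (sub_nonneg.2 h1)
  have hγ := ofReal_sqrt_mul_self h0
  push_cast at hs
  ext ⟨a, b⟩ ⟨c, d⟩
  fin_cases a <;> fin_cases b <;> fin_cases c <;> fin_cases d <;>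
    simp [choi, amplitudeDamping, conjMap_apply_fin_two, single_apply, dampingPopulations,
      bellCoherences, hs, hγ]

theorem choi_amplitudeDamping_kronecker_self {γ : ℝ} (h0 : 0 ≤ γ) (h1 : γ ≤ 1) :
    choi (amplitudeDamping γ) ⊗ₖ choi (amplitudeDamping γ) =
      twoDampings (γ : ℂ) (√(1 - γ) : ℂ) := by
  have hs := ofReal_sqrt_mul_self (sub_nonneg.2 h1)
  rw [choi_amplitudeDamping h0 h1, twoDampings, ← Complex.ofReal_one, ← Complex.ofReal_sub, ← hs]
  simp only [add_kronecker, kronecker_add, smul_kronecker, kronecker_smul]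
  module

theorem choi_bitFlip (η : ℝ) : choi (bitFlip η) = bitFlipChoi (η : ℂ) := by
  ext ⟨a, b⟩ ⟨c, d⟩
  fin_cases a <;> fin_cases b <;> fin_cases c <;> fin_cases d <;>
    simp [choi, bitFlip, conjMap_apply_fin_two, single_apply, bitFlipChoi]

/-- Two copies of the Choi operators of the two channels in `dampingFlipEnsemble`, where `s`
stands for `√(1 - 67/100)`. -/
def twoCopies {K : Type*} [Field K] (s : K) :
    Fin 2 → Matrix (QubitPair × QubitPair) (QubitPair × QubitPair) K :=
  ![twoDampings (67 / 100) s, bitFlipChoi (87 / 100) ⊗ₖ bitFlipChoi (87 / 100)]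

theorem choi_dampingFlipEnsemble_kronecker_self (i : Fin 2) :
    choi (dampingFlipEnsemble.channel i) ⊗ₖ choi (dampingFlipEnsemble.channel i) =
      twoCopies (√(1 - 67 / 100) : ℂ) i := by
  fin_cases i
  · exact (choi_amplitudeDamping_kronecker_self (by norm_num) (by norm_num)).trans
      (by simp [twoCopies])
  · simp [dampingFlipEnsemble, twoCopies, choi_bitFlip]

theorem map_twoCopies {K L : Type*} [Field K] [Field L] (f : K →+* L) (s : K) (i : Fin 2) :
    (twoCopies s i).map f = twoCopies (f s) i := by
  revert i
  exact Fin.forall_fin_two.2 ⟨(map_twoDampings f _ s).trans (by simp [twoCopies, map_ofNat]), by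
    ext x y
    simp [twoCopies, bitFlipChoi, apply_ite f, map_ofNat]⟩

theorem twoCopies_affine {K : Type*} [Field K] {a b : K} (hab : a + b = 1) (s t : K) :
    twoCopies (a * s + b * t) = a • twoCopies s + b • twoCopies t := by
  obtain rfl := eq_sub_of_add_eq' hab
  refine funext (Fin.forall_fin_two.2 ⟨?_, ?_⟩)
  · simp only [twoCopies, twoDampings, Pi.add_apply, Pi.smul_apply, cons_val_zero]
    module
  · simp only [twoCopies, Pi.add_apply, Pi.smul_apply, cons_val_one, cons_val_fin_one]
    module

/-- Ten-digit lower and upper approximations of `√(1 - 67/100)`. -/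
def sqrtBracket : Fin 2 → ℚ := ![5744562646 / 10 ^ 10, 5744562647 / 10 ^ 10]

theorem twoCopies_mem_of_convex {P : Set (Fin 2 → TwoSlot (Fin 2) (Fin 2))} (hP : Convex ℝ P)
    (h : ∀ j, twoCopies (sqrtBracket j : ℂ) ∈ P) : twoCopies (√(1 - 67 / 100) : ℂ) ∈ P := by
  have mem_segment : √(1 - 67 / 100) ∈ segment ℝ (sqrtBracket 0 : ℝ) (sqrtBracket 1) := by
    rw [segment_eq_Icc (by norm_num [sqrtBracket])]
    exact ⟨Real.le_sqrt_of_sq_le (by norm_num [sqrtBracket]),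
      Real.sqrt_le_iff.2 (by norm_num [sqrtBracket])⟩
  obtain ⟨a, b, ha, hb, hab, hs⟩ := mem_segment
  have decomposition : twoCopies (√(1 - 67 / 100) : ℂ) =
      a • twoCopies (sqrtBracket 0 : ℂ) + b • twoCopies (sqrtBracket 1 : ℂ) := by
    rw [← hs, smul_eq_mul, smul_eq_mul]
    push_cast
    exact twoCopies_affine (by exact_mod_cast hab) _ _
  exact decomposition ▸ hP (h 0) (h 1) ha hb hab

/-! ### Rational operators -/

/-- Rational operators on the four qubits `I₁ O₁ I₂ O₂`, in which certificates are written. -/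
abbrev RatOp := Matrix (QubitPair × QubitPair) (QubitPair × QubitPair) ℚ

/-- A rational operator as a complex one. -/
def ofRat : RatOp →+* TwoSlot (Fin 2) (Fin 2) := (Rat.castHom ℂ).mapMatrix

theorem replaceI₁_ofRat (X : RatOp) : replaceI₁ (ofRat X) = ofRat (traceReplace splitI₁ X) :=
  traceReplace_map splitI₁ (Rat.castHom ℂ) X

theorem replaceO₁_ofRat (X : RatOp) : replaceO₁ (ofRat X) = ofRat (traceReplace splitO₁ X) :=
  traceReplace_map splitO₁ (Rat.castHom ℂ) X

theorem replaceI₂_ofRat (X : RatOp) : replaceI₂ (ofRat X) = ofRat (traceReplace splitI₂ X) :=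
  traceReplace_map splitI₂ (Rat.castHom ℂ) X

theorem replaceO₂_ofRat (X : RatOp) : replaceO₂ (ofRat X) = ofRat (traceReplace splitO₂ X) :=
  traceReplace_map splitO₂ (Rat.castHom ℂ) X

theorem ofRat_smul (c : ℚ) (X : RatOp) : ofRat (c • X) = (c : ℂ) • ofRat X := by
  ext x y
  simp [ofRat]

theorem trace_ofRat (X : RatOp) : (ofRat X).trace = (X.trace : ℂ) :=
  (AddMonoidHom.map_trace (Rat.castHom ℂ) X).symm

theorem ofRat_twoCopies (s : ℚ) (i : Fin 2) : ofRat (twoCopies s i) = twoCopies (s : ℂ) i :=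
  map_twoCopies (Rat.castHom ℂ) s i

section Parity

/-- The basis of four qubits, sorted into blocks by the parities `i₁ + o₁` and `i₂ + o₂`; the
position in a block is the pair `(i₁, i₂)`, in the order `00, 01, 10, 11`. -/
def parityEquiv : Fin 4 × (Fin 2 × Fin 2) ≃ QubitPair × QubitPair where
  toFun q :=
    let i := finProdFinEquiv.symm q.1
    ((i.1, i.1 + q.2.1), (i.2, i.2 + q.2.2))
  invFun x := (finProdFinEquiv (x.1.1, x.2.1), (x.1.1 + x.1.2, x.2.1 + x.2.2))
  left_inv := by unfold Function.LeftInverse; decide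
  right_inv := by unfold Function.RightInverse Function.LeftInverse; decide

/-- The operator that preserves the parities and has the given blocks. -/
def ofBlocks (B : Fin 2 → Fin 2 → Matrix (Fin 4) (Fin 4) ℚ) : RatOp :=
  reindex parityEquiv parityEquiv (blockDiagonal fun c => B c.1 c.2)

/-- The block of the slot-exchanged operator that corresponds to the block `A`. -/
def swapBlock (A : Matrix (Fin 4) (Fin 4) ℚ) : Matrix (Fin 4) (Fin 4) ℚ :=
  A.submatrix ![0, 2, 1, 3] ![0, 2, 1, 3]

/-- The operator that preserves the parities and has the given blocks, where slot exchange fixes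
`A₀₀` and `A₁₁` and turns `A₀₁` into the block of parities `1, 0`. -/
def ofSwapBlocks (A₀₀ A₀₁ A₁₁ : Matrix (Fin 4) (Fin 4) ℚ) : RatOp :=
  ofBlocks ![![A₀₀, A₀₁], ![swapBlock A₀₁, A₁₁]]

/-- A decidable sufficient condition for positive definiteness: the operator preserves the
parities, and its blocks are symmetric with positive pivots. -/
def IsParityPositive (X : RatOp) : Prop :=
  let Y := reindex parityEquiv.symm parityEquiv.symm X
  Y = blockDiagonal (blockDiag Y) ∧
    ∀ c, (blockDiag Y c).IsSymm ∧ HasPositivePivots (blockDiag Y c)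

instance (X : RatOp) : Decidable (IsParityPositive X) := by
  unfold IsParityPositive IsSymm
  infer_instance

theorem IsParityPositive.posSemidef {X : RatOp} (hX : IsParityPositive X) :
    (ofRat X).PosSemidef := by
  obtain ⟨parity_preserving, hblock⟩ := hX
  set Y := reindex parityEquiv.symm parityEquiv.symm X
  have posSemidef_block (c) : ((blockDiag Y c).map (Rat.castHom ℂ)).PosSemidef := by
    refine ((hblock c).2.map (Rat.castHom ℂ) fun x hx => ?_).posSemidef ?_
    · change (0 : ℂ) < (x : ℂ)
      rw [← Complex.ofReal_ratCast]
      exact_mod_cast hx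
    · ext i j
      simpa using (hblock c).1.apply i j
  rw [← posSemidef_submatrix_equiv parityEquiv]
  change (Y.map (Rat.castHom ℂ)).PosSemidef
  rw [parity_preserving, blockDiagonal_map _ _ (map_zero _)]
  exact posSemidef_blockDiagonal posSemidef_block

end Parity

/-! ### Criteria for rational testers and dual operators -/

section Criteria

theorem isNormalizedPositive_ofRat {X : RatOp} (hX : (ofRat X).PosSemidef) (ht : X.trace = 4) :
    IsNormalizedPositive (ofRat X) := by
  refine ⟨hX, ?_⟩
  rw [trace_ofRat, ht]
  norm_num

theorem isParallelProcess_ofRat {X : RatOp} (hX : IsNormalizedPositive (ofRat X))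
    (h : X = traceReplace splitO₁ (traceReplace splitO₂ X)) : IsParallelProcess (ofRat X) :=
  ⟨hX, by rw [replaceO₂_ofRat, replaceO₁_ofRat, ← h]⟩

theorem isSequentialProcess_ofRat {X : RatOp} (hX : IsNormalizedPositive (ofRat X))
    (h₁ : X = traceReplace splitO₂ X)
    (h₂ : traceReplace splitI₂ (traceReplace splitO₂ X) =
      traceReplace splitO₁ (traceReplace splitI₂ (traceReplace splitO₂ X))) :
    IsSequentialProcess (ofRat X) :=
  ⟨hX, by rw [replaceO₂_ofRat, ← h₁],
    by rw [replaceO₂_ofRat, replaceI₂_ofRat, replaceO₁_ofRat, ← h₂]⟩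

theorem isGeneralProcess_ofRat {X : RatOp} (hX : IsNormalizedPositive (ofRat X))
    (h₁ : traceReplace splitI₁ (traceReplace splitO₁ X) =
      traceReplace splitI₁ (traceReplace splitO₁ (traceReplace splitO₂ X)))
    (h₂ : traceReplace splitI₂ (traceReplace splitO₂ X) =
      traceReplace splitO₁ (traceReplace splitI₂ (traceReplace splitO₂ X)))
    (h₃ : X = traceReplace splitO₁ X + traceReplace splitO₂ X -
      traceReplace splitO₁ (traceReplace splitO₂ X)) :
    IsGeneralProcess (ofRat X) := by
  refine ⟨hX, ?_, ?_, ?_⟩ <;>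
    simp only [replaceI₁_ofRat, replaceO₁_ofRat, replaceI₂_ofRat, replaceO₂_ofRat, ← map_add,
      ← map_sub]
  · rw [h₁]
  · rw [← h₂]
  · rw [← h₃]

theorem isTester_ofRat {S : Strategy} {N : ℕ} {T : Fin N → RatOp}
    (hT : ∀ i, IsParityPositive (T i)) (ht : (∑ i, T i).trace = 4)
    (hS : IsNormalizedPositive (ofRat (∑ i, T i)) → IsProcess S (ofRat (∑ i, T i))) :
    IsTester S fun i => ofRat (T i) := by
  have pos (i) := (hT i).posSemidef
  refine ⟨pos, ?_⟩
  rw [← map_sum]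
  exact hS (isNormalizedPositive_ofRat (map_sum ofRat T _ ▸ posSemidef_sum _ fun i _ => pos i) ht)

section Pairing

variable {W : TwoSlot (Fin 2) (Fin 2)} {M : RatOp} {c : ℚ}

theorem ofRat_smul_one (c : ℚ) : ofRat (c • 1) = (c : ℂ) • 1 := by
  rw [ofRat_smul, map_one]

theorem re_ratCast_mul_card_mul_card (c : ℚ) :
    ((c : ℂ) * (Fintype.card (Fin 2) * Fintype.card (Fin 2))).re = 4 * c := by
  have cast_eq : (c : ℂ) * (Fintype.card (Fin 2) * Fintype.card (Fin 2)) = ((4 * c : ℚ) : ℂ) := by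
    push_cast [Fintype.card_fin]
    ring
  rw [cast_eq, Complex.ratCast_re]
  norm_cast

theorem IsParallelProcess.re_trace_mul_ofRat (hW : IsParallelProcess W)
    (hM : traceReplace splitO₂ (traceReplace splitO₁ M) = c • 1) :
    (W * ofRat M).trace.re = 4 * c := by
  rw [hW.trace_mul (c := c), re_ratCast_mul_card_mul_card]
  rw [replaceO₁_ofRat, replaceO₂_ofRat, hM, ofRat_smul_one]

theorem IsSequentialProcess.re_trace_mul_ofRat (hW : IsSequentialProcess W)
    (hM : traceReplace splitO₂ M = traceReplace splitO₂ (traceReplace splitI₂ M))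
    (hM' : traceReplace splitO₂ (traceReplace splitI₂ (traceReplace splitO₁ M)) = c • 1) :
    (W * ofRat M).trace.re = 4 * c := by
  rw [hW.trace_mul (c := c), re_ratCast_mul_card_mul_card]
  · rw [replaceI₂_ofRat, replaceO₂_ofRat, replaceO₂_ofRat, hM]
  · rw [replaceO₁_ofRat, replaceI₂_ofRat, replaceO₂_ofRat, hM', ofRat_smul_one]

theorem IsGeneralProcess.re_trace_mul_ofRat (hW : IsGeneralProcess W)
    (hM : traceReplace splitO₁ M + traceReplace splitO₂ M
      - traceReplace splitO₂ (traceReplace splitO₁ M)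
      - traceReplace splitO₁ (traceReplace splitI₁ M)
      + traceReplace splitO₂ (traceReplace splitO₁ (traceReplace splitI₁ M))
      - traceReplace splitO₂ (traceReplace splitI₂ M)
      + traceReplace splitO₂ (traceReplace splitI₂ (traceReplace splitO₁ M)) = c • 1) :
    (W * ofRat M).trace.re = 4 * c := by
  rw [hW.trace_mul (c := c), re_ratCast_mul_card_mul_card]
  rw [← ofRat_smul_one, ← hM]
  simp only [replaceI₁_ofRat, replaceO₁_ofRat, replaceI₂_ofRat, replaceO₂_ofRat, map_add, map_sub]

theorem IsSeparableProcess.re_trace_mul_ofRat_le {M' : RatOp} (hW : IsSeparableProcess W)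
    (hM : swapSlots M = M) (hMM' : IsParityPositive (M' - M))
    (hM' : traceReplace splitO₂ M' = traceReplace splitO₂ (traceReplace splitI₂ M'))
    (hM'' : traceReplace splitO₂ (traceReplace splitI₂ (traceReplace splitO₁ M')) = c • 1) :
    (W * ofRat M).trace.re ≤ 4 * c :=
  hW.re_trace_mul_le (congrArg ofRat hM) (map_sub ofRat M' M ▸ hMM'.posSemidef)
    fun _ hV => (hV.re_trace_mul_ofRat hM' hM'').le

end Pairing

theorem lt_success_ofRat {T : Fin 2 → RatOp} {l : ℚ}
    (h : ∀ j, l < 1 / 2 * ∑ i, (T i * twoCopies (sqrtBracket j) i).trace) :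
    (l : ℝ) < dampingFlipEnsemble.success fun i => ofRat (T i) := by
  let success : (Fin 2 → TwoSlot (Fin 2) (Fin 2)) →ₗ[ℝ] ℝ :=
    { toFun C := ∑ i, 1 / 2 * (ofRat (T i) * C i).trace.re
      map_add' C C' := by
        simp only [Pi.add_apply, mul_add, trace_add, Complex.add_re, Finset.sum_add_distrib]
      map_smul' c C := by
        simp only [Pi.smul_apply, mul_smul_comm, trace_smul, Complex.smul_re, Finset.smul_sum,
          RingHom.id_apply] }
  have lt_success : twoCopies (√(1 - 67 / 100) : ℂ) ∈ {C | (l : ℝ) < success C} := by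
    refine twoCopies_mem_of_convex (convex_halfSpace_gt success.isLinear l) fun j => ?_
    have success_twoCopies : success (twoCopies (sqrtBracket j : ℂ)) =
        ((1 / 2 * ∑ i, (T i * twoCopies (sqrtBracket j) i).trace : ℚ) : ℝ) := by
      change ∑ i, 1 / 2 * (ofRat (T i) * twoCopies (sqrtBracket j : ℂ) i).trace.re = _
      simp only [← ofRat_twoCopies, ← map_mul, trace_ofRat, Complex.ratCast_re, Finset.mul_sum]
      push_cast
      rfl
    rw [Set.mem_ofPred_eq, success_twoCopies]
    exact_mod_cast h j
  have lt_sum : (l : ℝ) < success (twoCopies (√(1 - 67 / 100) : ℂ)) := lt_success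
  simp only [ChannelEnsemble.success, choi_dampingFlipEnsemble_kronecker_self]
  exact lt_sum

theorem posSemidef_ofRat_sub {M : RatOp}
    (h : ∀ j i, IsParityPositive (M - (1 / 2 : ℚ) • twoCopies (sqrtBracket j) i)) (i : Fin 2) :
    (ofRat M - (dampingFlipEnsemble.prob i : ℂ) • (choi (dampingFlipEnsemble.channel i) ⊗ₖ
      choi (dampingFlipEnsemble.channel i))).PosSemidef := by
  let dominated : Set (Fin 2 → TwoSlot (Fin 2) (Fin 2)) :=
    {C | ∀ i, (ofRat M - ((1 / 2 : ℝ) : ℂ) • C i).PosSemidef}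
  have convex_dominated : Convex ℝ dominated := by
    intro C hC C' hC' a b ha hb hab i
    have decomposition : ofRat M - ((1 / 2 : ℝ) : ℂ) • (a • C + b • C') i =
        a • (ofRat M - ((1 / 2 : ℝ) : ℂ) • C i) + b • (ofRat M - ((1 / 2 : ℝ) : ℂ) • C' i) := by
      obtain rfl := eq_sub_of_add_eq' hab
      simp only [Pi.add_apply, Pi.smul_apply]
      module
    exact decomposition ▸ ((hC i).smul ha).add ((hC' i).smul hb)
  have mem_dominated : twoCopies (√(1 - 67 / 100) : ℂ) ∈ dominated :=
    twoCopies_mem_of_convex convex_dominated fun j i => by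
      simpa [ofRat_smul, ofRat_twoCopies] using (h j i).posSemidef
  rw [choi_dampingFlipEnsemble_kronecker_self]
  exact mem_dominated i

end Criteria

/-! ### Certificates -/

/-- A near-optimal dual operator for parallel strategies. -/
def parallelDual : RatOp := (1 / 250000 : ℚ) • ofSwapBlocks
  !![157642, 112767, 112767, 89404;
     112767, 100228, 100215, 93005;
     112767, 100215, 100228, 93005;
     89404, 93005, 93005, 95075]
  !![22315, -6761, 20212, 4717;
     -6761, 86017, -6761, 46532;
     20212, -6761, 20219, 4717;
     4717, 46532, 4717, 28739]
  !![6395, 2190, 2190, 28;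
     2190, 2203, 2190, 28;
     2190, 2190, 2203, 28;
     28, 28, 28, 56114]

/-- A near-optimal parallel tester. -/
def parallelTester : Fin 2 → RatOp := ![
  (1 / 2500000 : ℚ) • ofSwapBlocks
    !![150, 183, 183, -400;
       183, 204649, 47532, -214679;
       183, 47532, 204649, -214679;
       -400, -214679, -214679, 365569]
    !![149, 16, -98, -195;
       16, 213345, 16685, 234630;
       -98, 16685, 53576, -205303;
       -195, 234630, -205303, 1217995]
    !![149, -74, -74, -12;
       -74, 78745, -78371, -12116;
       -74, -78371, 78745, -12116;
       -12, -12116, -12116, 1870288],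
  (1 / 2500000 : ℚ) • ofSwapBlocks
    !![149, -183, -183, 400;
       -183, 109584, -47532, 214679;
       -183, -47532, 109584, 214679;
       400, 214679, 214679, 1505666]
    !![150, -16, 98, 195;
       -16, 100888, -16685, -234630;
       98, -16685, 260657, 205303;
       195, -234630, 205303, 653240]
    !![150, 74, 74, 12;
       74, 235488, 78371, 12116;
       74, 78371, 235488, 12116;
       12, 12116, 12116, 947]]

/-- A near-optimal dual operator for sequential strategies. -/
def sequentialDual : RatOp := (1 / 25000000 : ℚ) • ofBlocks ![
  ![!![16069017, 11376281, 11648625, 9030691;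
       11376281, 10083759, 10072658, 9319656;
       11648625, 10072658, 10194346, 9323784;
       9030691, 9319656, 9323784, 9493699],
    !![2654453, -720148, 2317208, 456486;
       -720148, 8639711, -720148, 4646177;
       2317208, -720148, 2166551, 456486;
       456486, 4646177, 456486, 2867198]],
  ![!![1928301, 1687884, 169040, 736798;
       1687884, 1928301, 32255, 666381;
       169040, 32255, 8453451, 4825148;
       736798, 666381, 4825148, 3106010],
    !![465692, 225275, 362059, -64866;
       225275, 465692, 225275, -135282;
       362059, 225275, 303115, -64866;
       -64866, -135282, -64866, 5650556]]]

/-- A near-optimal sequential tester. -/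
def sequentialTester : Fin 2 → RatOp := ![
  (1 / 25000 : ℚ) • ofBlocks ![
    ![!![1475, 628, -3290, 1387;
         628, 374, -1404, 502;
         -3290, -1404, 7354, -3104;
         1387, 502, -3104, 1390],
      !![90, 265, -189, 859;
         265, 1667, -597, 4132;
         -189, -597, 412, -1938;
         859, 4132, -1938, 11386]],
    ![!![1834, -711, -3201, -2425;
         -711, 279, 1241, 934;
         -3201, 1241, 5612, 4231;
         -2425, 934, 4231, 3225],
      !![77, 37, -100, 90;
         37, 1220, -66, 4138;
         -100, -66, 141, -160;
         90, 4138, -160, 14133]]],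
  (1 / 25000 : ℚ) • ofBlocks ![
    ![!![375, -628, -856, -1387;
         -628, 1385, 1404, 3644;
         -856, 1404, 1969, 3104;
         -1387, 3644, 3104, 10678],
      !![1760, -265, -3957, -859;
         -265, 92, 597, 14;
         -3957, 597, 8911, 1938;
         -859, 14, 1938, 682]],
    ![!![545, 711, -939, 2425;
         711, 951, -1241, 3206;
         -939, -1241, 1642, -4231;
         2425, 3206, -4231, 10912],
      !![2302, -37, -4040, -90;
         -37, 10, 66, 2;
         -4040, 66, 7113, 160;
         -90, 2, 160, 4]]]]

/-- A near-optimal dual operator for separable strategies. -/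
def separableDual : RatOp := (1 / 25000000 : ℚ) • ofSwapBlocks
  !![15661638, 11548132, 11548132, 9175923;
     11548132, 10165433, 10165095, 9364541;
     11548132, 10165095, 10165433, 9364541;
     9175923, 9364541, 9364541, 9474705]
  !![1804594, -222024, 1801997, 634608;
     -222024, 8404657, -223202, 4730890;
     1801997, -223202, 1800591, 635049;
     634608, 4730890, 635049, 2988868]
  !![515899, 356076, 356076, -149676;
     356076, 285277, 285074, -119087;
     356076, 285074, 285277, -119087;
     -149676, -119087, -119087, 5661052]

/-- An operator that dominates `separableDual` and has the same trace against every sequential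
process. -/
def separableMajorant : RatOp := (1 / 25000000 : ℚ) • ofBlocks ![
  ![!![16216804, 11548132, 11919898, 9175923;
       11548132, 10168670, 10165095, 9363657;
       11919898, 10165095, 10414491, 9364541;
       9175923, 9363657, 9364541, 9474988],
    !![2359760, -222024, 2173765, 634608;
       -222024, 8407894, -223202, 4730006;
       2173765, -223202, 2049648, 635049;
       634608, 4730006, 635049, 2989151]],
  ![!![1964815, 1801997, -150810, 634608;
       1801997, 2078124, -223202, 515308;
       -150810, -223202, 8436370, 4730890;
       634608, 515308, 4730890, 3040588],
    !![676120, 356076, 427290, -149676;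
       356076, 562811, 285074, -238828;
       427290, 285074, 316990, -119087;
       -149676, -238828, -119087, 5712772]]]

/-- A near-optimal separable tester. -/
def separableTester : Fin 2 → RatOp := ![
  (1 / 500000 : ℚ) • ofSwapBlocks
    !![46074, -29630, -29630, 22420;
       -29630, 37862, 2358, -16236;
       -29630, 2358, 37862, -16236;
       22420, -16236, -16236, 14048]
    !![27046, -35692, -23190, -23440;
       -35692, 97616, 14754, 93458;
       -23190, 14754, 26004, -2740;
       -23440, 93458, -2740, 106858]
    !![622, 218, 218, 2908;
       218, 39508, -22024, 42472;
       218, -22024, 39508, 42472;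
       2908, 42472, 42472, 212736],
  (1 / 500000 : ℚ) • ofSwapBlocks
    !![4236, -7846, -7846, -22420;
       -7846, 33148, -2358, 53712;
       -7846, -2358, 33148, 53712;
       -22420, 53712, 53712, 293622]
    !![18567, -10126, -14286, 23440;
       -10126, 20750, -14754, -55982;
       -14286, -14754, 49703, 48558;
       23440, -55982, 48558, 153456]
    !![40294, -46036, -46036, -2908;
       -46036, 83555, 22024, 3346;
       -46036, 22024, 83555, 3346;
       -2908, 3346, 3346, 222]]

/-- A sequential process whose equal mixture with its slot exchange is the sum of
`separableTester`. -/
def separableOrdered : RatOp := (1 / 500000 : ℚ) • ofBlocks ![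
  ![!![50310, 0, -74952, 0;
       0, 30188, 0, 74952;
       -74952, 0, 111832, 0;
       0, 74952, 0, 307670],
    !![50310, 0, -74952, 0;
       0, 30188, 0, 74952;
       -74952, 0, 111832, 0;
       0, 74952, 0, 307670]],
  ![!![40916, 0, -91636, 0;
       0, 39582, 0, 91636;
       -91636, 0, 206544, 0;
       0, 91636, 0, 212958],
    !![40916, 0, -91636, 0;
       0, 39582, 0, 91636;
       -91636, 0, 206544, 0;
       0, 91636, 0, 212958]]]

/-- A near-optimal dual operator for general strategies. -/
def generalDual : RatOp := (1 / 250000 : ℚ) • ofSwapBlocks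
  !![165733, 118705, 118705, 91613;
     118705, 102787, 102774, 93595;
     118705, 102774, 102787, 93595;
     91613, 93595, 93595, 94740]
  !![21650, 265, 22000, 5599;
     265, 84596, 413, 47110;
     22000, 413, 22399, 5503;
     5599, 47110, 5503, 30446]
  !![3829, 3386, 3386, -2040;
     3386, 3080, 3073, -1852;
     3386, 3073, 3080, -1852;
     -2040, -1852, -1852, 57230]

/-- A near-optimal general tester. -/
def generalTester : Fin 2 → RatOp := ![
  (1 / 25000000 : ℚ) • ofSwapBlocks
    !![339015, -462768, -462768, 587016;
       -462768, 1470870, -207230, -801513;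
       -462768, -207230, 1470870, -801513;
       587016, -801513, -801513, 1016816]
    !![1416005, -2160052, -904396, -1820523;
       -2160052, 5970693, 828591, 4813638;
       -904396, 828591, 691139, 743304;
       -1820523, 4813638, 743304, 3890873]
    !![7978, 29005, 29005, 110920;
       29005, 2259813, -620213, 2776711;
       29005, -620213, 2259813, 2776711;
       110920, 2776711, 2776711, 9428574],
  (1 / 25000000 : ℚ) • ofSwapBlocks
    !![400762, -628597, -628597, -587016;
       -628597, 1885329, 207230, 1892878;
       -628597, 207230, 1885329, 1892878;
       -587016, 1892878, 1892878, 16531009]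
    !![978014, -695895, -186969, 1820523;
       -695895, 1443601, -828591, -3722273;
       -186969, -828591, 1010818, 2112643;
       1820523, -3722273, 2112643, 9598857]
    !![4040283, -2884952, -2884952, -110920;
       -2884952, 3500239, 620213, 79236;
       -2884952, 620213, 3500239, 79236;
       -110920, 79236, 79236, 3061]]

theorem isTester_parallelTester : IsTester .par fun i => ofRat (parallelTester i) :=
  isTester_ofRat (by decide +kernel) (by decide +kernel)
    fun hX => isParallelProcess_ofRat hX (by decide +kernel)

theorem isTester_sequentialTester : IsTester .seq fun i => ofRat (sequentialTester i) :=
  isTester_ofRat (by decide +kernel) (by decide +kernel)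
    fun hX => isSequentialProcess_ofRat hX (by decide +kernel) (by decide +kernel)

theorem isSequentialProcess_separableOrdered : IsSequentialProcess (ofRat separableOrdered) :=
  isSequentialProcess_ofRat
    (isNormalizedPositive_ofRat (IsParityPositive.posSemidef (by decide +kernel))
      (by decide +kernel))
    (by decide +kernel) (by decide +kernel)

theorem isTester_separableTester : IsTester .sep fun i => ofRat (separableTester i) := by
  have sum_eq : ∑ i, separableTester i =
      (1 / 2 : ℚ) • separableOrdered + (1 / 2 : ℚ) • swapSlots separableOrdered := by
    decide +kernel
  refine isTester_ofRat (by decide +kernel) (by decide +kernel) fun _ =>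
    ⟨1 / 2, _, ofRat (swapSlots separableOrdered), by norm_num, by norm_num,
      isSequentialProcess_separableOrdered,
      isReverseSequentialProcess_iff.2 isSequentialProcess_separableOrdered, ?_⟩
  rw [sum_eq, map_add, ofRat_smul, ofRat_smul]
  norm_num

theorem isTester_generalTester : IsTester .gen fun i => ofRat (generalTester i) :=
  isTester_ofRat (by decide +kernel) (by decide +kernel)
    fun hX => isGeneralProcess_ofRat hX (by decide +kernel) (by decide +kernel)
      (by decide +kernel)

/-! ### The maxima -/

theorem maxSuccess_par_mem_Ioo :
    dampingFlipEnsemble.maxSuccess .par ∈ Set.Ioo ((8346 : ℝ) / 10000) (8347 / 10000) := by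
  constructor
  · have lt_success := lt_success_ofRat (T := parallelTester) (l := 8346 / 10000)
      (by decide +kernel)
    push_cast at lt_success
    exact dampingFlipEnsemble.lt_maxSuccess isTester_parallelTester lt_success
  · calc dampingFlipEnsemble.maxSuccess .par
      _ ≤ 4 * ((208667 / 1000000 : ℚ) : ℝ) :=
        dampingFlipEnsemble.maxSuccess_le
          (posSemidef_ofRat_sub (M := parallelDual) (by decide +kernel))
          fun W (hW : IsParallelProcess W) => (hW.re_trace_mul_ofRat (by decide +kernel)).le
      _ < 8347 / 10000 := by norm_num

theorem maxSuccess_seq_mem_Ioo :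
    dampingFlipEnsemble.maxSuccess .seq ∈ Set.Ioo ((8446 : ℝ) / 10000) (8447 / 10000) := by
  constructor
  · have lt_success := lt_success_ofRat (T := sequentialTester) (l := 8446 / 10000)
      (by decide +kernel)
    push_cast at lt_success
    exact dampingFlipEnsemble.lt_maxSuccess isTester_sequentialTester lt_success
  · calc dampingFlipEnsemble.maxSuccess .seq
      _ ≤ 4 * ((21117463 / 100000000 : ℚ) : ℝ) :=
        dampingFlipEnsemble.maxSuccess_le
          (posSemidef_ofRat_sub (M := sequentialDual) (by decide +kernel))
          fun W (hW : IsSequentialProcess W) => (hW.re_trace_mul_ofRat (by decide +kernel)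
            (by decide +kernel)).le
      _ < 8447 / 10000 := by norm_num

theorem maxSuccess_sep_mem_Ioo :
    dampingFlipEnsemble.maxSuccess .sep ∈ Set.Ioo ((8486 : ℝ) / 10000) (8487 / 10000) := by
  constructor
  · have lt_success := lt_success_ofRat (T := separableTester) (l := 8486 / 10000)
      (by decide +kernel)
    push_cast at lt_success
    exact dampingFlipEnsemble.lt_maxSuccess isTester_separableTester lt_success
  · calc dampingFlipEnsemble.maxSuccess .sep
      _ ≤ 4 * ((21217499 / 100000000 : ℚ) : ℝ) :=
        dampingFlipEnsemble.maxSuccess_le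
          (posSemidef_ofRat_sub (M := separableDual) (by decide +kernel))
          fun W (hW : IsSeparableProcess W) => hW.re_trace_mul_ofRat_le
            (M' := separableMajorant) (by decide +kernel) (by decide +kernel) (by decide +kernel)
            (by decide +kernel)
      _ < 8487 / 10000 := by norm_num

theorem maxSuccess_gen_mem_Ioo :
    dampingFlipEnsemble.maxSuccess .gen ∈ Set.Ioo ((8514 : ℝ) / 10000) (8515 / 10000) := by
  constructor
  · have lt_success := lt_success_ofRat (T := generalTester) (l := 8514 / 10000)
      (by decide +kernel)
    push_cast at lt_success
    exact dampingFlipEnsemble.lt_maxSuccess isTester_generalTester lt_success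
  · calc dampingFlipEnsemble.maxSuccess .gen
      _ ≤ 4 * ((212862 / 1000000 : ℚ) : ℝ) :=
        dampingFlipEnsemble.maxSuccess_le
          (posSemidef_ofRat_sub (M := generalDual) (by decide +kernel))
          fun W (hW : IsGeneralProcess W) => (hW.re_trace_mul_ofRat (by decide +kernel)).le
      _ < 8515 / 10000 := by norm_num

end ChannelDiscrimination

end

theorem theorem1 :
    ∃ E : ChannelDiscrimination.ChannelEnsemble (Fin 2) (Fin 2) 2,
      -- the equiprobable pair of an amplitude-damping and a bit-flip channel
      (∀ i, E.prob i = 1 / 2) ∧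
      E.channel 0 = ChannelDiscrimination.amplitudeDamping (67 / 100) ∧
      E.channel 1 = ChannelDiscrimination.bitFlip (87 / 100) ∧
      -- the maxima exist
      (∀ S : ChannelDiscrimination.Strategy, IsGreatest (E.successSet S) (E.maxSuccess S)) ∧
      -- their enclosures
      (8346 / 10000 < E.maxSuccess .par ∧ E.maxSuccess .par < 8347 / 10000) ∧
      (8446 / 10000 < E.maxSuccess .seq ∧ E.maxSuccess .seq < 8447 / 10000) ∧
      (8486 / 10000 < E.maxSuccess .sep ∧ E.maxSuccess .sep < 8487 / 10000) ∧
      (8514 / 10000 < E.maxSuccess .gen ∧ E.maxSuccess .gen < 8515 / 10000) ∧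
      -- the strict hierarchy
      E.maxSuccess .par < E.maxSuccess .seq ∧
      E.maxSuccess .seq < E.maxSuccess .sep ∧
      E.maxSuccess .sep < E.maxSuccess .gen := by
  have par := ChannelDiscrimination.maxSuccess_par_mem_Ioo
  have seq := ChannelDiscrimination.maxSuccess_seq_mem_Ioo
  have sep := ChannelDiscrimination.maxSuccess_sep_mem_Ioo
  have gen := ChannelDiscrimination.maxSuccess_gen_mem_Ioo
  have par_lt_seq : (8347 : ℝ) / 10000 < 8446 / 10000 := by norm_num
  have seq_lt_sep : (8447 : ℝ) / 10000 < 8486 / 10000 := by norm_num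
  have sep_lt_gen : (8487 : ℝ) / 10000 < 8514 / 10000 := by norm_num
  exact ⟨ChannelDiscrimination.dampingFlipEnsemble, fun _ => rfl, rfl, rfl,
    ChannelDiscrimination.dampingFlipEnsemble.isGreatest_maxSuccess, par, seq, sep, gen,
    par.2.trans (par_lt_seq.trans seq.1), seq.2.trans (seq_lt_sep.trans sep.1),
    sep.2.trans (sep_lt_gen.trans gen.1)⟩
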